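/- Let a discrete group $G$ act by homeomorphisms on a compact Hausdorff space (compactum) $T$. *Conventions.* For an action of $G$ by homeomorphisms on a topological space $X$: the *cross* with center $(r,a)\in X^2$ is $(r,a)^\times=\{r\}\times X\cup X\times\{a\}$; for $S\subset G$, $\partial S\subset X^2$ is the set of all $(r,a)$ such that $(r,a)^\times$ lies in the closure, in the Vietoris topology, of the set of graphs of the maps $x\mapsto gx$, $g\in S$ (the centers of the limit crosses of $S$), and $\partial_0S,\partial_1S\subset X$ are its first and second projections. The *limit points* are the points of $\partial_0G$. An infinite set $S\subset G$ is a *cone* if $\partial_1S\cap\overline{S\cdot\partial_0S}=\varnothing$; a point $p$ is *conical* if $\partial_0S=\{p\}$ for some cone $S$. The action is *proper on triples* if for all compact sets $K,L$ of triples of distinct points of $X$ the set $\{g\in G: gK\cap L\neq\varnothing\}$ is finite, and *cocompact on pairs* if some compact set of pairs of distinct points of $X$ meets the $G$-orbit of every pair of distinct points. The *attractor sum* $\widetilde T=G+_GT$ is the disjoint union $G\sqcup T$, with $G$ acting on itself by left multiplication, in which a set $F$ is closed if and only if $F\cap T$ is closed in $T$ and $\partial_1(F\cap G)\subset F$, where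 $\partial_1$ is taken with respect to the action on $T$. The *uniformity of $\widetilde T$* is the filter of neighborhoods of the diagonal in $\widetilde T^2$. A $G$-set $M$ is *connected* if it is the vertex set of a connected graph without loops or multiple edges that is invariant under $G$ and has finitely many $G$-orbits of edges. A symmetric set $\mathbf u\subset M^2$ containing the diagonal is a *divider* if there is a finite $F\subset G$ with $\left(\bigcap_{f\in F}f\mathbf u\right)^2\subset\mathbf u$ (square in the sense of composition of relations), and it is *perspective* if $\{g\in G:g\beta\notin\mathbf u\}$ is finite for every $\beta\in M^2$. A uniformity $\mathcal U$ on a connected $G$-set $M$ is *relatively hyperbolic* (in the sense $\mathsf{RH_{pd}}$) if, as a filter, it is generated by the translates $g\mathbf u$, $g\in G$, of a perspective divider $\mathbf u$, and $\overline M\setminus M$ (the complement of the image of $M$ in the Hausdorff completion $\overline M$ of $(M,\mathcal U)$) has at least two points. **Proposition** ($\mathsf{RH_{32}\Rightarrow RH_{pd}}$). Suppose that the action of $G$ on $T$ is relatively hyperbolic in the sense $\mathsf{RH_{32}}$, i.e. it is proper on triples, cocompact on pairs and has at least two limit points. Let $M$ be the $G$-set of all non-conical points of the action of $G$ on $\widetilde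 T=G+_GT$. If the $G$-set $M$ is connected, then the filter induced on $M^2$ by the uniformity of $\widetilde T$ is a uniformity on $M$, and it is relatively hyperbolic in the sense $\mathsf{RH_{pd}}$. -/

import Mathlib

open Set Topology Uniformity
open scoped Pointwise

namespace RelHyp

/-! ### Limit crosses, limit points, cones

Throughout, `G` is a discrete group (no topology on `G` is used) acting by homeomorphisms on a
topological space `X`. A subset of `G` is bounded iff it is finite. -/

section Convergence

variable (G : Type*) (X : Type*) [Group G] [TopologicalSpace X] [MulAction G X]

/-- The graph of the map `x ↦ g • x`, as a subset of `X × X`. -/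
def graphOf {G : Type*} (X : Type*) [SMul G X] (g : G) : Set (X × X) := {p | p.2 = g • p.1}

/-- The cross `{r} × X ∪ X × {a}` with repeller `r = c.1` and attractor `a = c.2`. -/
def cross {X : Type*} (c : X × X) : Set (X × X) := {p | p.1 = c.1 ∨ p.2 = c.2}

/-- The centers of the limit crosses of `S ⊆ G`: the pairs `c` such that the cross with center `c`
belongs to the closure, in the Vietoris topology, of the set of graphs of the elements of `S`.
(As soon as `X` has at least two points, a cross is never itself the graph of a map.) -/
def limitCenters {G : Type*} (X : Type*) [Group G] [TopologicalSpace X] [MulAction G X]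
    (S : Set G) : Set (X × X) :=
  {c | cross c ∈ @closure (Set (X × X)) (TopologicalSpace.vietoris (X × X)) (graphOf X '' S)}

/-- The repelling set `∂₀ S`. -/
def repellingSet {G : Type*} (X : Type*) [Group G] [TopologicalSpace X] [MulAction G X]
    (S : Set G) : Set X := Prod.fst '' limitCenters X S

/-- The attracting set `∂₁ S`. -/
def attractingSet {G : Type*} (X : Type*) [Group G] [TopologicalSpace X] [MulAction G X]
    (S : Set G) : Set X := Prod.snd '' limitCenters X S

/-- The limit set `∂₀ G` of the action. -/
def limitSet : Set X := repellingSet X (univ : Set G)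

/-- A cone: an infinite set `S ⊆ G` such that `∂₁ S` does not meet the closure of `S • ∂₀ S`. -/
def IsCone {G : Type*} (X : Type*) [Group G] [TopologicalSpace X] [MulAction G X]
    (S : Set G) : Prop :=
  S.Infinite ∧ Disjoint (attractingSet X S) (closure (S • repellingSet X S))

/-- A point is conical if it is the vertex of a cone `S`, i.e. the unique point of `∂₀ S`. -/
def IsConical {X : Type*} [TopologicalSpace X] [MulAction G X] (p : X) : Prop :=
  ∃ S : Set G, IsCone X S ∧ repellingSet X S = {p}

/-- The action on the space of triples of distinct points is proper: for any two compact sets `K`,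
`L` of such triples, `g • K` meets `L` for finitely many `g` only. -/
def ProperOnTriples : Prop :=
  ∀ K L : Set (X × X × X), IsCompact K → IsCompact L →
    (∀ t ∈ K, t.1 ≠ t.2.1 ∧ t.1 ≠ t.2.2 ∧ t.2.1 ≠ t.2.2) →
    (∀ t ∈ L, t.1 ≠ t.2.1 ∧ t.1 ≠ t.2.2 ∧ t.2.1 ≠ t.2.2) →
    {g : G | ((g • K) ∩ L).Nonempty}.Finite

/-- The action on the space of pairs of distinct points is cocompact: some compact set of such
pairs meets every orbit. -/
def CocompactOnPairs : Prop :=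
  ∃ K : Set (X × X), IsCompact K ∧ (∀ q ∈ K, q.1 ≠ q.2) ∧
    ∀ x y : X, x ≠ y → ∃ g : G, g • (x, y) ∈ K

/-- Relatively hyperbolic actions on a compactum in the sense `32`: proper on triples, cocompact on
pairs, with at least two limit points. -/
structure IsRelHyp32 : Prop where
  properOnTriples : ProperOnTriples G X
  cocompactOnPairs : CocompactOnPairs G X
  two_limit_points : (limitSet G X).Nontrivial

variable {G X}

theorem limitCenters_mono {S S' : Set G} (h : S ⊆ S') :
    limitCenters X S ⊆ limitCenters X S' := by
  let _ := TopologicalSpace.vietoris (X × X)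
  intro c hc
  exact closure_mono (image_mono h) hc

theorem limitCenters_union (S S' : Set G) :
    limitCenters X (S ∪ S') = limitCenters X S ∪ limitCenters X S' := by
  let _ := TopologicalSpace.vietoris (X × X)
  ext c
  simp only [limitCenters, image_union, mem_ofPred_eq, mem_union]
  rw [closure_union, mem_union]

theorem limitCenters_empty : limitCenters X (∅ : Set G) = ∅ := by
  let _ := TopologicalSpace.vietoris (X × X)
  ext c
  simp [limitCenters]

theorem attractingSet_mono {S S' : Set G} (h : S ⊆ S') :
    attractingSet X S ⊆ attractingSet X S' := image_mono (limitCenters_mono h)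

theorem limitCenters_translate [ContinuousConstSMul G X] (g h : G) {S : Set G} {c : X × X}
    (hc : c ∈ limitCenters X S) :
    (g • c.1, h • c.2) ∈ limitCenters X ((fun s => h * s * g⁻¹) '' S) := by
  let _ := TopologicalSpace.vietoris (X × X)
  let f : X × X → X × X := fun p => (g • p.1, h • p.2)
  have hf : Continuous f := by fun_prop
  have key : ∀ A : Set (X × X), f '' A = {p | (g⁻¹ • p.1, h⁻¹ • p.2) ∈ A} := by
    intro A
    ext p
    constructor
    · rintro ⟨q, hq, rfl⟩
      simpa [f] using hq
    · intro hp
      exact ⟨_, hp, by simp [f]⟩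
  have h1 : cross (g • c.1, h • c.2) = f '' cross c := by
    rw [key]
    ext p
    simp [cross, inv_smul_eq_iff]
  have h2 : graphOf X '' ((fun s => h * s * g⁻¹) '' S) = (f '' ·) '' (graphOf X '' S) := by
    rw [image_image, image_image]
    refine image_congr fun s _ => ?_
    rw [key]
    ext p
    simp [graphOf, mul_smul, inv_smul_eq_iff]
  change cross (g • c.1, h • c.2) ∈ closure (graphOf X '' _)
  rw [h1, h2]
  exact image_closure_subset_closure_image hf.image_vietoris (mem_image_of_mem _ hc)

theorem IsConical.smul [ContinuousConstSMul G X] {p : X} (hp : IsConical G p) (g : G) :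
    IsConical G (g • p) := by
  obtain ⟨S, ⟨hS, hd⟩, hr⟩ := hp
  let S' : Set G := (fun s => 1 * s * g⁻¹) '' S
  have hcen : ∀ c : X × X, c ∈ limitCenters X S' ↔ (g⁻¹ • c.1, c.2) ∈ limitCenters X S := by
    intro c
    constructor
    · intro hc
      have := limitCenters_translate (g⁻¹) 1 hc
      simpa [S', image_image] using this
    · intro hc
      have := limitCenters_translate g 1 hc
      simpa [S'] using this
  have hatt : attractingSet X S' = attractingSet X S := by
    ext a
    constructor
    · rintro ⟨c, hc, rfl⟩
      exact ⟨_, (hcen c).1 hc, rfl⟩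
    · rintro ⟨c, hc, rfl⟩
      exact ⟨(g • c.1, c.2), (hcen _).2 (by simpa using hc), rfl⟩
  have hrep : repellingSet X S' = g • repellingSet X S := by
    ext a
    rw [mem_smul_set_iff_inv_smul_mem]
    constructor
    · rintro ⟨c, hc, rfl⟩
      exact ⟨_, (hcen c).1 hc, rfl⟩
    · rintro ⟨c, hc, h⟩
      refine ⟨(g • c.1, c.2), (hcen _).2 (by simpa using hc), ?_⟩
      simp only at h ⊢
      rw [h, smul_inv_smul]
  have hmul : S' • repellingSet X S' = S • repellingSet X S := by
    rw [hrep]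
    ext x
    simp only [mem_smul, mem_smul_set, S', mem_image]
    constructor
    · rintro ⟨_, ⟨s, hs, rfl⟩, _, ⟨r, hr, rfl⟩, rfl⟩
      exact ⟨s, hs, r, hr, by simp [mul_smul]⟩
    · rintro ⟨s, hs, r, hr, rfl⟩
      exact ⟨_, ⟨s, hs, rfl⟩, _, ⟨r, hr, rfl⟩, by simp [mul_smul]⟩
  refine ⟨S', ⟨hS.image (fun a _ b _ h => by simpa using h), ?_⟩, ?_⟩
  · rw [hatt, hmul]
    exact hd
  · rw [hrep, hr, smul_set_singleton]

/-- The `G`-set of non-conical points. -/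
def nonConical (G X : Type*) [Group G] [TopologicalSpace X] [MulAction G X]
    [ContinuousConstSMul G X] : SubMulAction G X where
  carrier := {p | ¬ IsConical G p}
  smul_mem' g p hp := fun h => hp (by simpa using h.smul g⁻¹)

end Convergence

/-! ### The attractor sum of `G` and a `G`-compactum -/

/-- The disjoint union of `G` and `T`; it carries the attractor sum topology below. -/
inductive AttractorSum (G T : Type*)
  | ofG (g : G) : AttractorSum G T
  | ofT (t : T) : AttractorSum G T

namespace AttractorSum

variable {G T : Type*} [Group G] [MulAction G T]

/-- `G` acts on itself by left multiplication and on `T` by the given action. -/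
instance : MulAction G (AttractorSum G T) where
  smul g x := match x with
    | ofG h => ofG (g * h)
    | ofT t => ofT (g • t)
  one_smul x := match x with
    | ofG h => congrArg ofG (one_mul h)
    | ofT t => congrArg ofT (one_smul G t)
  mul_smul g g' x := match x with
    | ofG h => congrArg ofG (mul_assoc g g' h)
    | ofT t => congrArg ofT (mul_smul g g' t)

variable [TopologicalSpace T]

/-- A set `F` is closed in the attractor sum iff `F ∩ T` is closed in `T` and contains the
attracting set `∂₁(F ∩ G)` (every subset of the discrete group `G` is closed in `G`). -/
instance : TopologicalSpace (AttractorSum G T) :=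
  TopologicalSpace.ofClosed
    {F : Set (AttractorSum G T) | IsClosed (ofT ⁻¹' F) ∧
      attractingSet T (ofG ⁻¹' F) ⊆ ofT ⁻¹' F}
    (by simp [attractingSet, limitCenters_empty])
    (by
      intro A hA
      refine ⟨?_, ?_⟩
      · rw [preimage_sInter]
        exact isClosed_biInter fun F hF => (hA hF).1
      · intro a ha F hF
        exact (hA hF).2 (attractingSet_mono (preimage_mono (sInter_subset_of_mem hF)) ha))
    (by
      rintro A ⟨hA1, hA2⟩ B ⟨hB1, hB2⟩
      refine ⟨hA1.union hB1, ?_⟩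
      rw [preimage_union, preimage_union, attractingSet, limitCenters_union, image_union]
      exact union_subset_union hA2 hB2)

theorem isClosed_iff {F : Set (AttractorSum G T)} :
    IsClosed F ↔ IsClosed (ofT ⁻¹' F) ∧ attractingSet T (ofG ⁻¹' F) ⊆ ofT ⁻¹' F := by
  rw [← isOpen_compl_iff]
  change Fᶜᶜ ∈ _ ↔ _
  rw [compl_compl]
  rfl

instance [ContinuousConstSMul G T] : ContinuousConstSMul G (AttractorSum G T) where
  continuous_const_smul g := by
    refine continuous_iff_isClosed.2 fun F hF => ?_
    obtain ⟨h1, h2⟩ := isClosed_iff.1 hF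
    refine isClosed_iff.2 ⟨h1.preimage (continuous_const_smul g), ?_⟩
    rintro _ ⟨c, hc, rfl⟩
    have := limitCenters_translate 1 g hc
    refine h2 ⟨_, limitCenters_mono ?_ this, rfl⟩
    rintro _ ⟨s, hs, rfl⟩
    change ofG (g * s * 1⁻¹) ∈ F
    rw [inv_one, mul_one]
    exact hs

end AttractorSum

/-! ### Relatively hyperbolic uniformities on connected `G`-sets -/

section Divider

/-- A `G`-set `M` is connected if it is the vertex set of a connected graph, invariant under `G`,
having finitely many `G`-orbits of edges. -/
def IsConnectedGSet (G M : Type*) [Group G] [MulAction G M] : Prop :=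
  ∃ Γ : SimpleGraph M, Γ.Connected ∧ (∀ (g : G) (x y : M), Γ.Adj x y → Γ.Adj (g • x) (g • y)) ∧
    ∃ F : Set (M × M), F.Finite ∧ ∀ x y, Γ.Adj x y → ∃ (g : G), ∃ e ∈ F, (x, y) = g • e

/-- A divider: a symmetric set `u` of pairs containing the diagonal such that
`(⋂ f ∈ F, f • u)² ⊆ u` for some finite `F ⊆ G`. -/
structure IsDivider (G : Type*) {M : Type*} [Group G] [MulAction G M] (u : Set (M × M)) :
    Prop where
  refl : ∀ x, (x, x) ∈ u
  symm : ∀ x y, (x, y) ∈ u → (y, x) ∈ u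
  divides : ∃ F : Finset G, ∀ x y z : M,
    (x, y) ∈ ⋂ f ∈ F, f • u → (y, z) ∈ ⋂ f ∈ F, f • u → (x, z) ∈ u

/-- `u` is perspective: for every pair `β`, `g • β ∈ u` for all but finitely many `g`. -/
def IsPerspective (G : Type*) {M : Type*} [Group G] [MulAction G M] (u : Set (M × M)) : Prop :=
  ∀ β : M × M, {g : G | g • β ∉ u}.Finite

/-- The uniformity `U` on the connected `G`-set `M` is relatively hyperbolic: as a filter it is
generated by the translates of a perspective divider, and its boundary, i.e. the complement of the
image of `M` in the completion, has at least two points. -/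
structure IsRelHypUniformity (G : Type*) {M : Type*} [Group G] [MulAction G M]
    (U : UniformSpace M) : Prop where
  connected : IsConnectedGSet G M
  divider : ∃ u : Set (M × M), IsDivider G u ∧ IsPerspective G u ∧
    𝓤 M = ⨅ g : G, Filter.principal (g • u)
  not_parabolic : ((range ((↑) : M → UniformSpace.Completion M))ᶜ).Nontrivial

/-- The uniformity of a compactum `X`: the filter of neighborhoods of the diagonal. -/
def ent (X : Type*) [TopologicalSpace X] : Filter (X × X) := 𝓝ˢ (diagonal X)

end Divider

end RelHyp

/-! Write `T̃` for the attractor sum. Everything rests on the convergence property: along a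
nonprincipal ultrafilter on `G`, graphs accumulate on a cross. Properness on triples yields it on
`T` (`ProperOnTriples.isConvergence`); it makes `T̃` compact Hausdorff and passes to `T̃`
(`crossLimit_ofT`).

Cocompactness on pairs also passes to `T̃`. On such a compactum, the translates of a closed
symmetric entourage missing the compact fundamental set intersect in the diagonal. By compactness
they generate the uniformity, and the entourage is a divider (`CocompactOnPairs.exists_divider`).

Its trace on `M` is perspective: infinitely many elements keeping `x` and `y` apart contain a cone
at `x` or at `y` (`exists_isConical_of_separated`), whereas `M` has no conical points.

The boundary comes from the conical points of `T̃`. They are limit points, so they lie in the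
closure of `G ⊆ M` but not in `M`. A contracting element and its inverse provide two of them
(`nontrivial_isConical`). -/

namespace RelHyp

open Filter

/-! ### Limit crosses through ultrafilters -/

section CrossLimits

variable {G X : Type*} [Group G] [TopologicalSpace X] [MulAction G X]

/-- Along the filter `l`, the graphs of the elements of `G` accumulate on the cross with
center `(r, a)`: the complement of any neighborhood of `r` is eventually mapped into any given
neighborhood of `a`. -/
def CrossLimit (l : Filter G) (r a : X) : Prop :=
  ∀ R ∈ 𝓝 r, ∀ A ∈ 𝓝 a, ∀ᶠ g in l, ∀ x ∉ R, g • x ∈ A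

theorem CrossLimit.tendsto_smul [T1Space X] {l : Filter G} {r a x : X} (h : CrossLimit l r a)
    (hx : x ≠ r) : Tendsto (fun g : G => g • x) l (𝓝 a) := fun A hA =>
  (h {x}ᶜ (compl_singleton_mem_nhds hx.symm) A hA).mono fun _ hg => hg x (by simp)

theorem CrossLimit.tendsto_inv_smul [T1Space X] {l : Filter G} {r a y : X}
    (h : CrossLimit l r a) (hy : y ≠ a) : Tendsto (fun g : G => g⁻¹ • y) l (𝓝 r) := fun R hR =>
  (h R hR {y}ᶜ (compl_singleton_mem_nhds hy.symm)).mono fun g hg => by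
    by_contra hyR
    exact hg _ hyR (by simp)

theorem exists_ultrafilter_crossLimit {S : Set G} {r a : X}
    (h : ∀ R ∈ 𝓝 r, ∀ A ∈ 𝓝 a, ∃ g ∈ S, ∀ x ∉ R, g • x ∈ A) :
    ∃ f : Ultrafilter G, S ∈ f ∧ CrossLimit (f : Filter G) r a := by
  let B : {p : Set X × Set X // p.1 ∈ 𝓝 r ∧ p.2 ∈ 𝓝 a} → Set G :=
    fun p => {g | g ∈ S ∧ ∀ x ∉ p.1.1, g • x ∈ p.1.2}
  have : Nonempty {p : Set X × Set X // p.1 ∈ 𝓝 r ∧ p.2 ∈ 𝓝 a} :=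
    ⟨⟨(univ, univ), univ_mem, univ_mem⟩⟩
  have hne : (⨅ p, 𝓟 (B p)).NeBot := by
    refine iInf_neBot_of_directed' ?_ fun p => ?_
    · intro p q
      refine ⟨⟨(p.1.1 ∩ q.1.1, p.1.2 ∩ q.1.2), inter_mem p.2.1 q.2.1, inter_mem p.2.2 q.2.2⟩,
        ?_, ?_⟩
      · exact principal_mono.2 fun g hg => ⟨hg.1, fun x hx => (hg.2 x fun h => hx h.1).1⟩
      · exact principal_mono.2 fun g hg => ⟨hg.1, fun x hx => (hg.2 x fun h => hx h.2).2⟩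
    · exact principal_neBot_iff.2 (h _ p.2.1 _ p.2.2)
  obtain ⟨f, hf⟩ := Ultrafilter.exists_le (⨅ p, 𝓟 (B p))
  have hB : ∀ p, B p ∈ f := fun p => hf (mem_iInf_of_mem p (mem_principal_self _))
  refine ⟨f, mem_of_superset (hB ⟨(univ, univ), univ_mem, univ_mem⟩) fun g hg => hg.1, ?_⟩
  exact fun R hR A hA => mem_of_superset (hB ⟨(R, A), hR, hA⟩) fun g hg => hg.2

theorem exists_of_mem_limitCenters {S : Set G} {r a : X} (h : (r, a) ∈ limitCenters X S)
    {R A : Set X} (hR : R ∈ 𝓝 r) (hA : A ∈ 𝓝 a) : ∃ g ∈ S, ∀ x ∉ R, g • x ∈ A := by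
  let _ := TopologicalSpace.vietoris (X × X)
  have hU : IsOpen {p : X × X | p.1 ∈ interior R ∨ p.2 ∈ interior A} :=
    (isOpen_interior.preimage continuous_fst).union (isOpen_interior.preimage continuous_snd)
  obtain ⟨_, hg, g, hgS, rfl⟩ := mem_closure_iff.1 h _ hU.powerset_vietoris (by
    rintro p (hp | hp)
    · exact Or.inl (hp ▸ mem_interior_iff_mem_nhds.2 hR)
    · exact Or.inr (hp ▸ mem_interior_iff_mem_nhds.2 hA))
  refine ⟨g, hgS, fun x hx => ?_⟩
  rcases hg (show (x, g • x) ∈ graphOf X g from rfl) with h' | h'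
  · exact absurd (interior_subset h') hx
  · exact interior_subset h'

/-- In a discrete space a Vietoris neighborhood of a cross can require two points over the repeller,
which no graph has. Hence two limit points force the space to be infinite. -/
theorem limitSet_eq_empty_of_finite [T1Space X] [Finite X] [Nontrivial X] : limitSet G X = ∅ := by
  let _ := TopologicalSpace.vietoris (X × X)
  refine eq_empty_of_forall_notMem ?_
  rintro _ ⟨⟨r, a⟩, hc, rfl⟩
  obtain ⟨y, hy⟩ := exists_ne a
  have key : IsOpen ({s : Set (X × X) | (s ∩ {(r, a)}).Nonempty} ∩
      {s | (s ∩ {(r, y)}).Nonempty}) :=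
    (TopologicalSpace.vietoris.isOpen_inter_nonempty_of_isOpen (isOpen_discrete _)).inter
      (TopologicalSpace.vietoris.isOpen_inter_nonempty_of_isOpen (isOpen_discrete _))
  obtain ⟨_, ⟨⟨p, hp, hp'⟩, ⟨q, hq, hq'⟩⟩, g, -, rfl⟩ := mem_closure_iff.1 hc _ key
    ⟨⟨(r, a), Or.inl rfl, rfl⟩, ⟨(r, y), Or.inl rfl, rfl⟩⟩
  rw [mem_singleton_iff] at hp' hq'
  subst hp' hq'
  exact hy (hq.trans hp.symm)

theorem infinite_of_limitSet_nontrivial [T1Space X] (h : (limitSet G X).Nontrivial) :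
    Infinite X := by
  by_contra hX
  rw [not_infinite_iff_finite] at hX
  have : Nontrivial X := h.elim fun x ⟨_, y, _, hxy⟩ => ⟨x, y, hxy⟩
  simp [limitSet_eq_empty_of_finite] at h

/-- A cross is never a limit of a constant net of graphs. -/
theorem CrossLimit.ultrafilter_le_cofinite [T1Space X] [Infinite X] {f : Ultrafilter G}
    {r a : X} (h : CrossLimit (f : Filter G) r a) : (f : Filter G) ≤ cofinite := by
  rcases f.le_cofinite_or_eq_pure with hf | ⟨g, rfl⟩
  · exact hf
  obtain ⟨x, hx⟩ := (Set.toFinite {r, g⁻¹ • a}).exists_notMem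
  simp only [mem_singleton_iff, mem_insert_iff, not_or] at hx
  have hgx : a ≠ g • x := fun h => hx.2 (by simp [h])
  have := h.tendsto_smul hx.1 (compl_singleton_mem_nhds hgx)
  simp at this

variable [CompactSpace X] [T2Space X] [Infinite X]

theorem CrossLimit.tendsto_graphOf {l : Filter G} {r a : X} (h : CrossLimit l r a) :
    Tendsto (fun g : G => graphOf X g) l
      (@nhds _ (TopologicalSpace.vietoris (X × X)) (cross (r, a))) := by
  refine TopologicalSpace.tendsto_nhds_generateFrom_iff.2 ?_
  rintro _ (⟨U, hU, rfl⟩ | ⟨V, hV, rfl⟩) hc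
  · obtain ⟨R, _, hR, -, hrR, hR', hRU⟩ := generalized_tube_lemma (isCompact_singleton (x := r))
      (isCompact_univ (X := X)) hU (fun p hp => hc (Or.inl hp.1))
    obtain ⟨_, A, -, hA, hA', haA, hAU⟩ := generalized_tube_lemma (isCompact_univ (X := X))
      (isCompact_singleton (x := a)) hU (fun p hp => hc (Or.inr hp.2))
    filter_upwards [h R (hR.mem_nhds (hrR rfl)) A (hA.mem_nhds (haA rfl))] with g hg
    rintro ⟨x, y⟩ (rfl : y = g • x)
    by_cases hx : x ∈ R
    · exact hRU ⟨hx, hR' trivial⟩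
    · exact hAU ⟨hA' trivial, hg x hx⟩
  · replace hV : IsOpen V := hV
    have left : ∀ x, x ≠ r → (x, a) ∈ V → ∀ᶠ g in l, (graphOf X g ∩ V).Nonempty := by
      intro x hx hxV
      have := (tendsto_const_nhds (x := x)).prodMk_nhds (h.tendsto_smul hx)
      filter_upwards [this (hV.mem_nhds hxV)] with g hg using ⟨_, rfl, hg⟩
    have right : ∀ y, y ≠ a → (r, y) ∈ V → ∀ᶠ g in l, (graphOf X g ∩ V).Nonempty := by
      intro y hy hyV
      have := (h.tendsto_inv_smul hy).prodMk_nhds (tendsto_const_nhds (x := y))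
      filter_upwards [this (hV.mem_nhds hyV)] with g hg using ⟨_, by simp [graphOf], hg⟩
    -- The center is approximated by other points of the arms unless `r` and `a` are both isolated.
    -- In that case `g` would send two distinct points to `a`, against injectivity.
    have corner : (r, a) ∈ V → ∀ᶠ g in l, (graphOf X g ∩ V).Nonempty := by
      intro hra
      by_cases h1 : ∃ x, x ≠ r ∧ (x, a) ∈ V
      · exact left _ h1.choose_spec.1 h1.choose_spec.2
      by_cases h2 : ∃ y, y ≠ a ∧ (r, y) ∈ V
      · exact right _ h2.choose_spec.1 h2.choose_spec.2
      push Not at h1 h2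
      have hr : {r} ∈ 𝓝 r := by
        have : Continuous fun x : X => (x, a) := by fun_prop
        exact mem_of_superset ((hV.preimage this).mem_nhds hra)
          fun x hx => by_contra fun hxr => h1 x hxr hx
      have ha : {a} ∈ 𝓝 a := by
        have : Continuous fun y : X => (r, y) := by fun_prop
        exact mem_of_superset ((hV.preimage this).mem_nhds hra)
          fun y hy => by_contra fun hya => h2 y hya hy
      obtain ⟨x, hx⟩ := exists_ne r
      obtain ⟨y, hy⟩ := (Set.toFinite {r, x}).exists_notMem
      simp only [mem_singleton_iff, mem_insert_iff, not_or] at hy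
      filter_upwards [h _ hr _ ha] with g hg
      exact absurd (smul_left_cancel g ((hg y hy.1).trans (hg x hx).symm)) hy.2
    obtain ⟨⟨x, y⟩, hxy | hxy, hV'⟩ := hc <;> simp only at hxy <;> subst hxy
    · by_cases hy : y = a
      · exact corner (hy ▸ hV')
      · exact right y hy hV'
    · by_cases hx : x = r
      · exact corner (hx ▸ hV')
      · exact left x hx hV'

theorem CrossLimit.mem_limitCenters {S : Set G} {f : Filter G} [f.NeBot] (hS : S ∈ f) {r a : X}
    (h : CrossLimit f r a) : (r, a) ∈ limitCenters X S := by
  let _ := TopologicalSpace.vietoris (X × X)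
  exact mem_closure_of_tendsto h.tendsto_graphOf
    (mem_of_superset hS fun g hg => mem_image_of_mem _ hg)

theorem mem_limitCenters_iff_ultrafilter {S : Set G} {r a : X} :
    (r, a) ∈ limitCenters X S ↔
      ∃ f : Ultrafilter G, S ∈ f ∧ CrossLimit (f : Filter G) r a :=
  ⟨fun h => exists_ultrafilter_crossLimit fun _ hR _ hA => exists_of_mem_limitCenters h hR hA,
    fun ⟨_, hS, hf⟩ => hf.mem_limitCenters hS⟩

theorem mem_limitCenters_iff {S : Set G} {r a : X} :
    (r, a) ∈ limitCenters X S ↔ ∀ R ∈ 𝓝 r, ∀ A ∈ 𝓝 a, ∃ g ∈ S, ∀ x ∉ R, g • x ∈ A :=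
  ⟨fun h _ hR _ hA => exists_of_mem_limitCenters h hR hA,
    fun h => mem_limitCenters_iff_ultrafilter.2 (exists_ultrafilter_crossLimit h)⟩

theorem infinite_of_mem_limitCenters {S : Set G} {c : X × X} (h : c ∈ limitCenters X S) :
    S.Infinite := by
  obtain ⟨f, hS, hf⟩ := mem_limitCenters_iff_ultrafilter.1 (show (c.1, c.2) ∈ _ from h)
  intro hfin
  exact f.empty_notMem (by
    simpa using inter_mem hS (hf.ultrafilter_le_cofinite hfin.compl_mem_cofinite))

theorem attractingSet_subset_closure {S : Set G} {R A : Set X} (hR : Rᶜ.Nontrivial)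
    (h : ∀ g ∈ S, ∀ x ∉ R, g • x ∈ A) : attractingSet X S ⊆ closure A := by
  rintro _ ⟨⟨r, a⟩, hc, rfl⟩
  by_contra ha
  obtain ⟨z, hz, hzr⟩ := hR.exists_ne r
  obtain ⟨g, hg, hgz⟩ := mem_limitCenters_iff.1 hc {z}ᶜ (compl_singleton_mem_nhds hzr.symm)
    _ (isClosed_closure.isOpen_compl.mem_nhds ha)
  exact hgz z (by simp) (subset_closure (h g hg z hz))

theorem repellingSet_subset_closure {S : Set G} {R A : Set X} (hA : Aᶜ.Nontrivial)
    (h : ∀ g ∈ S, ∀ x ∉ R, g • x ∈ A) : repellingSet X S ⊆ closure R := by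
  rintro _ ⟨⟨r, a⟩, hc, rfl⟩
  by_contra hr
  obtain ⟨z, hz, hza⟩ := hA.exists_ne a
  obtain ⟨g, hg, hgz⟩ := mem_limitCenters_iff.1 hc _ (isClosed_closure.isOpen_compl.mem_nhds hr)
    {z}ᶜ (compl_singleton_mem_nhds hza.symm)
  have : g⁻¹ • z ∈ R := by
    by_contra h'
    exact hz (by simpa using h g hg _ h')
  exact hgz (g⁻¹ • z) (fun h' => h' (subset_closure this)) (by simp)

end CrossLimits

/-! ### From properness on triples to the convergence property -/

section ProperOnTriples

/-- A relation with full domain and full range having no matching of size three is contained in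
a cross. -/
theorem exists_cross_of_no_matching {X : Type*} [Infinite X] {Φ : X → X → Prop}
    (hl : ∀ x, ∃ y, Φ x y) (hr : ∀ y, ∃ x, Φ x y)
    (h3 : ∀ x₁ y₁ x₂ y₂ x₃ y₃, Φ x₁ y₁ → Φ x₂ y₂ → Φ x₃ y₃ → x₁ ≠ x₂ → x₁ ≠ x₃ → x₂ ≠ x₃ →
      y₁ ≠ y₂ → y₁ ≠ y₃ → y₂ ≠ y₃ → False) :
    ∃ r a, ∀ x y, Φ x y → x = r ∨ y = a := by
  -- a relation with a matching of size two, one value of which has two preimages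
  have main : ∀ x₁ y₁ x₂ y₂ x₃, Φ x₁ y₁ → Φ x₂ y₂ → Φ x₃ y₁ → x₁ ≠ x₂ → x₃ ≠ x₁ → x₃ ≠ x₂ →
      y₁ ≠ y₂ → ∃ r a, ∀ x y, Φ x y → x = r ∨ y = a := by
    intro x₁ y₁ x₂ y₂ x₃ h₁ h₂ h₃ hx hx₁ hx₂ hy
    -- A preimage of a third value `y₄` must be `x₂`, because `x₁` and `x₃` are interchangeable over
    -- `y₁`. Then `x₂` has two values and `y₁` two preimages, so a pair off the cross `(x₂, y₁)`
    -- extends to a matching of size three.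
    obtain ⟨y₄, hy₄⟩ := (Set.toFinite {y₁, y₂}).exists_notMem
    simp only [mem_insert_iff, mem_singleton_iff, not_or] at hy₄
    obtain ⟨x₄, h₄⟩ := hr y₄
    have : x₄ = x₂ := by
      by_contra hne
      by_cases h41 : x₄ = x₁
      · exact h3 _ _ _ _ _ _ h₃ h₂ h₄ hx₂ (by grind) (Ne.symm hne) hy (Ne.symm hy₄.1)
          (Ne.symm hy₄.2)
      · exact h3 _ _ _ _ _ _ h₁ h₂ h₄ hx (Ne.symm h41) (Ne.symm hne) hy (Ne.symm hy₄.1)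
          (Ne.symm hy₄.2)
    subst this
    refine ⟨x₄, y₁, fun x y hxy => ?_⟩
    by_contra! hne
    obtain ⟨x', hx', hx'x, hx'4⟩ : ∃ x', Φ x' y₁ ∧ x' ≠ x ∧ x' ≠ x₄ := by
      by_cases e : x₁ = x
      · exact ⟨x₃, h₃, e ▸ hx₁, hx₂⟩
      · exact ⟨x₁, h₁, e, hx⟩
    obtain ⟨y', hy', hy'y, hy'1⟩ : ∃ y', Φ x₄ y' ∧ y' ≠ y ∧ y' ≠ y₁ := by
      by_cases e : y₂ = y
      · exact ⟨y₄, h₄, e ▸ hy₄.2, hy₄.1⟩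
      · exact ⟨y₂, h₂, e, Ne.symm hy⟩
    exact h3 _ _ _ _ _ _ hx' hy' hxy hx'4 hx'x (Ne.symm hne.1) (Ne.symm hy'1) (Ne.symm hne.2) hy'y
  -- a matching of size two
  obtain ⟨x₁, y₁, x₂, y₂, h₁, h₂, hx, hy⟩ : ∃ x₁ y₁ x₂ y₂, Φ x₁ y₁ ∧ Φ x₂ y₂ ∧ x₁ ≠ x₂ ∧
      y₁ ≠ y₂ := by
    obtain ⟨x⟩ : Nonempty X := inferInstance
    obtain ⟨y, hxy⟩ := hl x
    obtain ⟨y', hy'⟩ := exists_ne y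
    obtain ⟨x', hx'⟩ := hr y'
    by_cases e : x' = x
    · subst e
      obtain ⟨x'', hx''⟩ := exists_ne x'
      obtain ⟨y'', hy''⟩ := hl x''
      by_cases e' : y'' = y
      · exact ⟨x'', y'', x', y', hy'', hx', hx'', e' ▸ hy'.symm⟩
      · exact ⟨x'', y'', x', y, hy'', hxy, hx'', e'⟩
    · exact ⟨x, y, x', y', hxy, hx', Ne.symm e, hy'.symm⟩
  obtain ⟨x₃, hx₃⟩ := (Set.toFinite {x₁, x₂}).exists_notMem
  simp only [mem_insert_iff, mem_singleton_iff, not_or] at hx₃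
  obtain ⟨y₃, h₃⟩ := hl x₃
  by_cases e₁ : y₃ = y₁
  · exact main x₁ y₁ x₂ y₂ x₃ h₁ h₂ (e₁ ▸ h₃) hx hx₃.1 hx₃.2 hy
  by_cases e₂ : y₃ = y₂
  · exact main x₂ y₂ x₁ y₁ x₃ h₂ h₁ (e₂ ▸ h₃) hx.symm hx₃.2 hx₃.1 hy.symm
  exact (h3 _ _ _ _ _ _ h₁ h₂ h₃ hx (Ne.symm hx₃.1) (Ne.symm hx₃.2) hy (Ne.symm e₁)
    (Ne.symm e₂)).elim

variable {G X : Type*} [Group G] [TopologicalSpace X] [MulAction G X]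

/-- The convergence property: along every nonprincipal ultrafilter the graphs accumulate on a
cross. -/
def IsConvergence (G X : Type*) [Group G] [TopologicalSpace X] [MulAction G X] : Prop :=
  ∀ f : Ultrafilter G, (f : Filter G) ≤ cofinite → ∃ r a : X, CrossLimit (f : Filter G) r a

theorem exists_compact_nhds_distinct [CompactSpace X] [T2Space X] {x y z : X} (hxy : x ≠ y)
    (hxz : x ≠ z) (hyz : y ≠ z) :
    ∃ K : Set (X × X × X), IsCompact K ∧ (∀ t ∈ K, t.1 ≠ t.2.1 ∧ t.1 ≠ t.2.2 ∧ t.2.1 ≠ t.2.2) ∧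
      ∃ U ∈ 𝓝 x, ∃ V ∈ 𝓝 y, ∃ W ∈ 𝓝 z, U ×ˢ V ×ˢ W ⊆ K := by
  have hD : IsOpen {t : X × X × X | t.1 ≠ t.2.1 ∧ t.1 ≠ t.2.2 ∧ t.2.1 ≠ t.2.2} := by
    refine ((isOpen_ne_fun ?_ ?_).inter ((isOpen_ne_fun ?_ ?_).inter (isOpen_ne_fun ?_ ?_))) <;>
      fun_prop
  obtain ⟨K, hK, hKD, hKc⟩ := local_compact_nhds (hD.mem_nhds (x := (x, y, z)) ⟨hxy, hxz, hyz⟩)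
  obtain ⟨U, hU, Z, hZ, hUZ⟩ := mem_nhds_prod_iff.1 hK
  obtain ⟨V, hV, W, hW, hVW⟩ := mem_nhds_prod_iff.1 hZ
  exact ⟨K, hKc, fun t ht => hKD ht, U, hU, V, hV, W, hW,
    (prod_mono_right hVW).trans hUZ⟩

/-- The limit relation `Φ` of the graphs along `f` has full domain and range by compactness. A
matching of size three in it would give infinitely many `g` moving one compact set of triples to
meet another. So `Φ` lies in a cross, and a compactness argument off the cross gives uniform
contraction. -/
theorem ProperOnTriples.isConvergence [CompactSpace X] [T2Space X] [Infinite X]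
    (hp : ProperOnTriples G X) : IsConvergence G X := by
  intro f hf
  let Φ : X → X → Prop := fun x y => ∀ U ∈ 𝓝 x, ∀ V ∈ 𝓝 y, ∀ᶠ g in (f : Filter G),
    ∃ z ∈ U, g • z ∈ V
  have hl : ∀ x, ∃ y, Φ x y := fun x => by
    obtain ⟨y, -, hy⟩ := isCompact_iff_ultrafilter_le_nhds.1 (isCompact_univ (X := X))
      (f.map fun g => g • x) (by simp)
    exact ⟨y, fun U hU V hV => mem_of_superset (hy hV) fun g hg => ⟨x, mem_of_mem_nhds hU, hg⟩⟩
  have hr : ∀ y, ∃ x, Φ x y := fun y => by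
    obtain ⟨x, -, hx⟩ := isCompact_iff_ultrafilter_le_nhds.1 (isCompact_univ (X := X))
      (f.map fun g => g⁻¹ • y) (by simp)
    exact ⟨x, fun U hU V hV => mem_of_superset (hx hU) fun g hg =>
      ⟨g⁻¹ • y, hg, by simpa using mem_of_mem_nhds hV⟩⟩
  obtain ⟨r, a, hra⟩ := exists_cross_of_no_matching hl hr (by
    intro x₁ y₁ x₂ y₂ x₃ y₃ h₁ h₂ h₃ hx12 hx13 hx23 hy12 hy13 hy23
    obtain ⟨K, hK, hKd, U₁, hU₁, U₂, hU₂, U₃, hU₃, hUK⟩ := exists_compact_nhds_distinct hx12 hx13 hx23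
    obtain ⟨L, hL, hLd, V₁, hV₁, V₂, hV₂, V₃, hV₃, hVL⟩ := exists_compact_nhds_distinct hy12 hy13 hy23
    have hfin := (hp K L hK hL hKd hLd).compl_mem_cofinite
    obtain ⟨g, hg, ⟨z₁, hz₁, hg₁⟩, ⟨z₂, hz₂, hg₂⟩, ⟨z₃, hz₃, hg₃⟩⟩ := f.nonempty_of_mem
      (inter_mem (hf hfin) (inter_mem (h₁ U₁ hU₁ V₁ hV₁) (inter_mem (h₂ U₂ hU₂ V₂ hV₂)
        (h₃ U₃ hU₃ V₃ hV₃))))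
    exact hg ⟨g • (z₁, z₂, z₃), smul_mem_smul_set (hUK ⟨hz₁, hz₂, hz₃⟩), hVL ⟨hg₁, hg₂, hg₃⟩⟩)
  refine ⟨r, a, fun R hR A hA => ?_⟩
  have key : ∀ᶠ g in (f : Filter G), ∀ p ∈ (interior R)ᶜ ×ˢ (interior A)ᶜ, p.2 ≠ g • p.1 := by
    refine IsCompact.induction_on (isOpen_interior.isClosed_compl.prod
      isOpen_interior.isClosed_compl).isCompact (p := fun s : Set (X × X) =>
        ∀ᶠ g in (f : Filter G), ∀ p ∈ s, p.2 ≠ g • p.1) (by simp) ?_ ?_ ?_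
    · exact fun s t hst ht => ht.mono fun g hg p hp => hg p (hst hp)
    · intro s t hs ht
      filter_upwards [hs, ht] with g hg hg' p hp
      exact hp.elim (hg p) (hg' p)
    · rintro ⟨x, y⟩ ⟨hx, hy⟩
      have hxy : ¬ Φ x y := fun h => by
        rcases hra x y h with rfl | rfl
        · exact hx (mem_interior_iff_mem_nhds.2 hR)
        · exact hy (mem_interior_iff_mem_nhds.2 hA)
      simp only [Φ, not_forall] at hxy
      obtain ⟨U, hU, V, hV, hUV⟩ := hxy
      refine ⟨U ×ˢ V, mem_nhdsWithin_of_mem_nhds (prod_mem_nhds hU hV), ?_⟩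
      refine (Ultrafilter.eventually_not.2 hUV).mono fun g hg p hp e => hg ⟨p.1, hp.1, e ▸ hp.2⟩
  filter_upwards [key] with g hg x hx
  by_contra hgx
  exact hg (x, g • x) ⟨fun h => hx (interior_subset h), fun h => hgx (interior_subset h)⟩ rfl

theorem IsConvergence.limitCenters_nonempty [CompactSpace X] [T2Space X] [Infinite X]
    (hc : IsConvergence G X) {S : Set G} (hS : S.Infinite) : (limitCenters X S).Nonempty := by
  have := cofinite_inf_principal_neBot_iff.2 hS
  obtain ⟨f, hf⟩ := Ultrafilter.exists_le (cofinite ⊓ 𝓟 S)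
  obtain ⟨r, a, h⟩ := hc f (hf.trans inf_le_left)
  exact ⟨_, h.mem_limitCenters (hf (mem_inf_of_right (mem_principal_self S)))⟩

end ProperOnTriples

/-! ### The attractor sum is a compactum with the convergence property -/

namespace AttractorSum

theorem ofG_injective {G T : Type*} : Function.Injective (ofG : G → AttractorSum G T) :=
  fun _ _ h => by injection h

theorem ofT_injective {G T : Type*} : Function.Injective (ofT : T → AttractorSum G T) :=
  fun _ _ h => by injection h

theorem ultrafilter_eq_map_ofG_or_map_ofT {G T : Type*} (f : Ultrafilter (AttractorSum G T)) :
    (∃ f' : Ultrafilter G, f'.map ofG = f) ∨ ∃ f' : Ultrafilter T, f'.map ofT = f := by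
  have h : range (ofG : G → AttractorSum G T) ∪ range ofT ∈ f := by
    refine mem_of_superset univ_mem ?_
    rintro (g | t) -
    · exact Or.inl ⟨g, rfl⟩
    · exact Or.inr ⟨t, rfl⟩
  rcases Ultrafilter.union_mem_iff.1 h with h | h
  · refine Or.inl ⟨f.comap ofG_injective h, Ultrafilter.coe_injective ?_⟩
    rw [Ultrafilter.coe_map, Ultrafilter.coe_comap, map_comap_of_mem h]
  · refine Or.inr ⟨f.comap ofT_injective h, Ultrafilter.coe_injective ?_⟩
    rw [Ultrafilter.coe_map, Ultrafilter.coe_comap, map_comap_of_mem h]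

variable {G T : Type*} [Group G] [TopologicalSpace T] [MulAction G T]

theorem attractingSet_empty : attractingSet T (∅ : Set G) = ∅ := by
  simp [attractingSet, limitCenters_empty]

theorem isClosedEmbedding_ofT : IsClosedEmbedding (ofT : T → AttractorSum G T) := by
  refine .of_continuous_injective_isClosedMap ?_ ofT_injective fun C hC => ?_
  · exact continuous_iff_isClosed.2 fun F hF => (isClosed_iff.1 hF).1
  · have : (ofG ⁻¹' (ofT '' C) : Set G) = ∅ := by ext; simp
    rw [isClosed_iff, preimage_image_eq _ ofT_injective, this, attractingSet_empty]
    exact ⟨hC, empty_subset _⟩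

theorem isOpen_singleton_ofG (g : G) : IsOpen ({ofG g} : Set (AttractorSum G T)) := by
  have : (ofT ⁻¹' {ofG g}ᶜ : Set T) = univ := by ext; simp
  rw [← isClosed_compl_iff, isClosed_iff, this]
  exact ⟨isClosed_univ, subset_univ _⟩

instance [Infinite T] : Infinite (AttractorSum G T) := .of_injective _ ofT_injective

variable [CompactSpace T] [T2Space T] [Infinite T]

theorem tendsto_ofG {f : Ultrafilter G} {r a : T} (h : CrossLimit (f : Filter G) r a) :
    Tendsto (ofG : G → AttractorSum G T) f (𝓝 (ofT a)) := by
  refine tendsto_nhds.2 fun O hO ha => ?_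
  by_contra hf
  have hmem : ofG ⁻¹' Oᶜ ∈ f := Ultrafilter.compl_mem_iff_notMem.2 hf
  exact (isClosed_iff.1 hO.isClosed_compl).2 ⟨_, h.mem_limitCenters hmem, rfl⟩ ha

theorem isClosed_singleton_ofG (g : G) : IsClosed ({ofG g} : Set (AttractorSum G T)) := by
  have h1 : (ofT ⁻¹' {(ofG g : AttractorSum G T)} : Set T) = ∅ := by ext; simp
  have h2 : (ofG ⁻¹' {(ofG g : AttractorSum G T)} : Set G) = {g} := by
    ext; simp [ofG_injective.eq_iff]
  rw [isClosed_iff, h1, h2]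
  refine ⟨isClosed_empty, ?_⟩
  rintro _ ⟨c, hc, rfl⟩
  exact (infinite_of_mem_limitCenters hc (finite_singleton g)).elim

theorem compactSpace (hc : IsConvergence G T) : CompactSpace (AttractorSum G T) := by
  refine isCompact_univ_iff.1 (isCompact_iff_ultrafilter_le_nhds.2 fun f _ => ?_)
  obtain ⟨f, rfl⟩ | ⟨f, rfl⟩ := ultrafilter_eq_map_ofG_or_map_ofT f
  · rcases f.le_cofinite_or_eq_pure with hf | ⟨g, rfl⟩
    · obtain ⟨r, a, h⟩ := hc f hf
      exact ⟨_, trivial, tendsto_ofG h⟩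
    · exact ⟨ofG g, trivial, by simpa using pure_le_nhds _⟩
  · obtain ⟨t, -, ht⟩ := isCompact_iff_ultrafilter_le_nhds.1 (isCompact_univ (X := T)) f (by simp)
    exact ⟨ofT t, trivial, isClosedEmbedding_ofT.continuous.continuousAt.tendsto.mono_left ht⟩

/-- Elements sending two fixed points into `A` have their attractors in `closure A`. Together with
`closure A` they form a closed set of the attractor sum, which separates `a` from any other
candidate limit. -/
theorem eq_of_tendsto_ofG {f : Ultrafilter G} {r a : T} (h : CrossLimit (f : Filter G) r a)
    {x : AttractorSum G T} (hx : Tendsto ofG f (𝓝 x)) : x = ofT a := by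
  rcases x with g | p
  · exfalso
    have hg : {g} ∈ f := mem_of_superset (hx ((isOpen_singleton_ofG g).mem_nhds rfl))
      fun g' hg' => ofG_injective hg'
    have := h.ultrafilter_le_cofinite (finite_singleton g).compl_mem_cofinite
    exact f.empty_notMem (by simpa using inter_mem hg this)
  · by_contra hne
    replace hne : a ≠ p := fun e => hne (by rw [e])
    obtain ⟨A, hA, P, hP, hAP⟩ := t2_separation_nhds hne |>.elim fun A ⟨P, hA, hP, h⟩ =>
      (⟨A, hA, P, hP, h⟩ : ∃ A ∈ 𝓝 a, ∃ P ∈ 𝓝 p, Disjoint A P)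
    obtain ⟨z, hz⟩ := exists_ne r
    obtain ⟨z', hz'⟩ := (Set.toFinite {r, z}).exists_notMem
    simp only [mem_insert_iff, mem_singleton_iff, not_or] at hz'
    have hR : ({z, z'} : Set T)ᶜ ∈ 𝓝 r := (Set.toFinite {z, z'}).isClosed.isOpen_compl.mem_nhds
      (by simp [hz.symm, Ne.symm hz'.1])
    let S : Set G := {g | ∀ x ∉ ({z, z'} : Set T)ᶜ, g • x ∈ A}
    have hS : S ∈ f := h _ hR A hA
    have hSA : attractingSet T S ⊆ closure A := attractingSet_subset_closure
      (by rw [compl_compl]; exact ⟨z, by simp, z', by simp, Ne.symm hz'.2⟩) fun g hg => hg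
    let F : Set (AttractorSum G T) := ofG '' S ∪ ofT '' closure A
    have hFG : ofG ⁻¹' F = S := by ext; simp [F, ofG_injective.eq_iff]
    have hFT : ofT ⁻¹' F = closure A := by ext; simp [F, ofT_injective.eq_iff]
    have hF : IsClosed F := by
      rw [isClosed_iff, hFG, hFT]
      exact ⟨isClosed_closure, hSA⟩
    have hpF : ofT p ∈ F := hF.mem_of_tendsto hx (mem_of_superset hS fun g hg => by
      exact Or.inl ⟨g, hg, rfl⟩)
    have hpA : p ∈ closure A := by rw [← hFT]; exact hpF
    exact (mem_closure_iff_nhds.1 hpA P hP).elim fun _ h => hAP.le_bot ⟨h.2, h.1⟩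

theorem t2Space (hc : IsConvergence G T) : T2Space (AttractorSum G T) := by
  refine t2_iff_ultrafilter.2 fun {x y} f hx hy => ?_
  obtain ⟨f, rfl⟩ | ⟨f, rfl⟩ := ultrafilter_eq_map_ofG_or_map_ofT f
  · rcases f.le_cofinite_or_eq_pure with hf | ⟨g, rfl⟩
    · obtain ⟨r, a, h⟩ := hc f hf
      rw [eq_of_tendsto_ofG h hx, eq_of_tendsto_ofG h hy]
    · have key : ∀ z : AttractorSum G T, Tendsto ofG (pure g) (𝓝 z) → z = ofG g := by
        rintro (h | t) hz
        · simpa using (hz ((isOpen_singleton_ofG h).mem_nhds rfl)).symm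
        · have := hz ((isClosed_singleton_ofG g).isOpen_compl.mem_nhds (by simp : (ofT t : AttractorSum G T) ∈ _))
          simp at this
      rw [key x hx, key y hy]
  · have key : ∀ z : AttractorSum G T, Tendsto ofT (f : Filter T) (𝓝 z) →
        ∃ t, z = ofT t ∧ (f : Filter T) ≤ 𝓝 t := by
      intro z hz
      obtain ⟨t, rfl⟩ := isClosedEmbedding_ofT.isClosed_range.mem_of_tendsto hz
        (Eventually.of_forall fun t => mem_range_self t)
      exact ⟨t, rfl, isClosedEmbedding_ofT.isInducing.tendsto_nhds_iff.2 hz⟩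
    obtain ⟨s, rfl, hs⟩ := key x hx
    obtain ⟨t, rfl, ht⟩ := key y hy
    rw [t2_iff_ultrafilter.1 inferInstance f hs ht]

/-- The limit crosses of the action on `T` are limit crosses of the action on the attractor sum. -/
theorem crossLimit_ofT [ContinuousConstSMul G T] (hc : IsConvergence G T) {f : Ultrafilter G} {r a : T}
    (h : CrossLimit (f : Filter G) r a) :
    CrossLimit (f : Filter G) (ofT r : AttractorSum G T) (ofT a) := by
  intro R hR A hA
  have hRT : ofT ⁻¹' R ∈ 𝓝 r := isClosedEmbedding_ofT.continuous.continuousAt hR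
  have hAT : ofT ⁻¹' A ∈ 𝓝 a := isClosedEmbedding_ofT.continuous.continuousAt hA
  suffices hG : ∀ᶠ g in (f : Filter G), ∀ k : G, ofG k ∉ R → ofG (g * k) ∈ A by
    filter_upwards [hG, h _ hRT _ hAT] with g hg hg'
    rintro (k | t) hx
    · exact hg k hx
    · exact hg' t hx
  by_contra hcon
  rw [← Ultrafilter.eventually_not] at hcon
  -- Choose a witness `k g` of failure for each bad `g`; the contradiction is that `g * k g`
  -- nevertheless converges to `a`.
  have : ∀ g : G, ∃ k : G, (¬ ∀ k : G, ofG k ∉ R → (ofG (g * k) : AttractorSum G T) ∈ A) →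
      ofG k ∉ R ∧ (ofG (g * k) : AttractorSum G T) ∉ A := by
    intro g
    by_cases hg : ∀ k : G, ofG k ∉ R → (ofG (g * k) : AttractorSum G T) ∈ A
    · exact ⟨1, fun h => absurd hg h⟩
    · push Not at hg
      exact hg.imp fun k hk _ => hk
  choose k hk using this
  have hkR : ∀ᶠ g in (f : Filter G), (ofG (k g) : AttractorSum G T) ∉ R :=
    hcon.mono fun g hg => (hk g hg).1
  -- the elements `g * k g` accumulate on a cross with attractor `a`
  have : ∃ r', CrossLimit (f.map fun g => g * k g : Filter G) r' a := by
    -- If `k g` escapes, its attractor differs from `r`, since `k g` stays outside `R`; so `g`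
    -- contracts a neighborhood of that attractor towards `a`. If `k g` is eventually constant, only
    -- the repeller is translated.
    rcases (f.map k).le_cofinite_or_eq_pure with hf | ⟨k₀, hk₀⟩
    · obtain ⟨r', a', h'⟩ := hc _ hf
      have ha' : a' ≠ r := by
        rintro rfl
        have : ∀ᶠ g in (f : Filter G), (ofG (k g) : AttractorSum G T) ∈ R := tendsto_ofG h' hR
        exact f.empty_notMem (mem_of_superset (inter_mem this hkR) fun g hg => hg.2 hg.1)
      refine ⟨r', fun R' hR' A' hA' => ?_⟩
      obtain ⟨B, hB, hBcl, hBr⟩ := exists_mem_nhds_isClosed_subset (compl_singleton_mem_nhds ha')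
      have h1 : ∀ᶠ g in (f : Filter G), ∀ x ∉ R', k g • x ∈ B := h' R' hR' B hB
      have h2 := h Bᶜ (hBcl.isOpen_compl.mem_nhds fun hr => hBr hr rfl) A' hA'
      change ∀ᶠ g in (f : Filter G), _
      filter_upwards [h1, h2] with g hg hg' x hx
      rw [mul_smul]
      exact hg' _ fun hn => hn (hg x hx)
    · have hconst : ∀ᶠ g in (f : Filter G), k g = k₀ := by
        have : {k₀} ∈ f.map k := by rw [hk₀]; simp
        exact this
      refine ⟨k₀⁻¹ • r, fun R' hR' A' hA' => ?_⟩
      have := h ((k₀⁻¹ • ·) ⁻¹' R') ((continuous_const_smul k₀⁻¹).continuousAt hR') A' hA'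
      change ∀ᶠ g in (f : Filter G), _
      filter_upwards [hconst, this] with g hg hg' x hx
      rw [hg, mul_smul]
      exact hg' _ (by simpa using hx)
  obtain ⟨r', h'⟩ := this
  have hA' : ∀ᶠ g in (f : Filter G), (ofG (g * k g) : AttractorSum G T) ∈ A :=
    tendsto_ofG (f := f.map fun g => g * k g) h' hA
  exact f.empty_notMem (mem_of_superset (inter_mem hA' hcon) fun g hg => (hk g hg.2).2 hg.1)

theorem isConvergence [ContinuousConstSMul G T] (hc : IsConvergence G T) :
    IsConvergence G (AttractorSum G T) :=
  fun f hf => (hc f hf).elim fun _ ⟨_, h⟩ => ⟨_, _, crossLimit_ofT hc h⟩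

end AttractorSum

/-! ### Producing conical points -/

section ConicalPoints

variable {G X : Type*} [Group G] [TopologicalSpace X] [MulAction G X]

theorem IsConical.mem_limitSet {p : X} (h : IsConical G p) : p ∈ limitSet G X := by
  obtain ⟨S, -, hS⟩ := h
  obtain ⟨c, hc, rfl⟩ : p ∈ repellingSet X S := hS ▸ rfl
  exact ⟨c, limitCenters_mono (subset_univ _) hc, rfl⟩

variable [CompactSpace X] [T2Space X] [Infinite X]

/-- If the elements of `S` do not bring `x` and `y` together then `S` repels from `x` and `y`
only. -/
theorem repellingSet_subset_pair {S : Set G} {x y : X}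
    (h : ∀ a : X, ∃ V ∈ 𝓝 a, ∀ g ∈ S, g • x ∈ V → g • y ∉ V) : repellingSet X S ⊆ {x, y} := by
  rintro _ ⟨⟨r, a⟩, hc, rfl⟩
  by_contra hr
  obtain ⟨V, hV, hSV⟩ := h a
  obtain ⟨g, hg, hgV⟩ := mem_limitCenters_iff.1 hc {x, y}ᶜ
    ((Set.toFinite {x, y}).isClosed.isOpen_compl.mem_nhds hr) V hV
  exact hSV g hg (hgV x (by simp)) (hgV y (by simp))

/-- Keep only the elements mapping the complement of a small `R ∋ x` into a small `A ⊆ interior V`.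
They send `y` into `A`, hence keep `x` outside `V`, so the orbit closure of `x` misses the
attractors. Since `y ∉ R`, the only repeller left is `x`. -/
theorem isConical_of_mem_limitCenters {S : Set G} {x y a : X}
    (hxy : x ≠ y) (h : ∀ a : X, ∃ V ∈ 𝓝 a, ∀ g ∈ S, g • x ∈ V → g • y ∉ V)
    (hxa : (x, a) ∈ limitCenters X S) : IsConical G x := by
  obtain ⟨V, hV, hSV⟩ := h a
  -- small closed neighborhoods `R` of `x` and `A` of `a`
  obtain ⟨b, hb⟩ := exists_ne a
  obtain ⟨c, hc⟩ := (Set.toFinite {a, b}).exists_notMem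
  simp only [mem_insert_iff, mem_singleton_iff, not_or] at hc
  obtain ⟨z, hz⟩ := (Set.toFinite {x, y}).exists_notMem
  simp only [mem_insert_iff, mem_singleton_iff, not_or] at hz
  have hA' : interior V ∩ {b, c}ᶜ ∈ 𝓝 a := inter_mem (interior_mem_nhds.2 hV)
    ((Set.toFinite {b, c}).isClosed.isOpen_compl.mem_nhds (by simp [hb.symm, Ne.symm hc.1]))
  obtain ⟨A, hA, hAcl, hAV⟩ := exists_mem_nhds_isClosed_subset hA'
  have hR' : ({y, z}ᶜ : Set X) ∈ 𝓝 x :=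
    (Set.toFinite {y, z}).isClosed.isOpen_compl.mem_nhds (by simp [hxy, Ne.symm hz.1])
  obtain ⟨R, hR, hRcl, hRy⟩ := exists_mem_nhds_isClosed_subset hR'
  have hyR : y ∉ R := fun h => hRy h (by simp)
  have hzR : z ∉ R := fun h => hRy h (by simp)
  have hRnt : Rᶜ.Nontrivial := ⟨y, hyR, z, hzR, Ne.symm hz.2⟩
  have hAnt : Aᶜ.Nontrivial :=
    ⟨b, fun h => (hAV h).2 (by simp), c, fun h => (hAV h).2 (by simp), Ne.symm hc.2⟩
  let S' : Set G := {g | g ∈ S ∧ ∀ w ∉ R, g • w ∈ A}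
  have hS'S : S' ⊆ S := fun g hg => hg.1
  have hxaS' : (x, a) ∈ limitCenters X S' := by
    refine mem_limitCenters_iff.2 fun R₁ hR₁ A₁ hA₁ => ?_
    obtain ⟨g, hg, hgw⟩ := mem_limitCenters_iff.1 hxa _ (inter_mem hR hR₁) _ (inter_mem hA hA₁)
    exact ⟨g, ⟨hg, fun w hw => (hgw w fun h => hw h.1).1⟩, fun w hw => (hgw w fun h => hw h.2).2⟩
  have hrep : repellingSet X S' = {x} := by
    refine Subset.antisymm (fun r hr => ?_) (singleton_subset_iff.2 ⟨_, hxaS', rfl⟩)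
    have h1 : r ∈ R := hRcl.closure_eq ▸ repellingSet_subset_closure hAnt (fun g hg => hg.2) hr
    rcases repellingSet_subset_pair h (image_mono (limitCenters_mono hS'S) hr) with h2 | h2
    · exact h2
    · exact absurd (mem_singleton_iff.1 h2 ▸ h1) hyR
  have hatt : attractingSet X S' ⊆ A :=
    (attractingSet_subset_closure hRnt fun g hg => hg.2).trans hAcl.closure_eq.subset
  refine ⟨S', ⟨infinite_of_mem_limitCenters hxaS', ?_⟩, hrep⟩
  have hcl : closure (S' • repellingSet X S') ⊆ (interior V)ᶜ := by
    refine closure_minimal ?_ isOpen_interior.isClosed_compl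
    rw [hrep]
    rintro _ ⟨g, hg, _, rfl, rfl⟩ hgx
    exact hSV g hg.1 (interior_subset hgx) (interior_subset (hAV (hg.2 y hyR)).1)
  exact disjoint_left.2 fun p hp hp' => hcl hp' (hAV (hatt hp)).1

theorem exists_isConical_of_separated (hconv : IsConvergence G X) {S : Set G} (hS : S.Infinite)
    {x y : X} (hxy : x ≠ y) (h : ∀ a : X, ∃ V ∈ 𝓝 a, ∀ g ∈ S, g • x ∈ V → g • y ∉ V) :
    ∃ p ∈ repellingSet X S, (p = x ∨ p = y) ∧ IsConical G p := by
  obtain ⟨⟨r, a⟩, hc⟩ := hconv.limitCenters_nonempty hS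
  rcases repellingSet_subset_pair h ⟨_, hc, rfl⟩ with hr | hr <;>
    simp only [mem_singleton_iff] at hr <;> subst hr
  · exact ⟨r, ⟨_, hc, rfl⟩, Or.inl rfl, isConical_of_mem_limitCenters hxy h hc⟩
  · refine ⟨r, ⟨_, hc, rfl⟩, Or.inr rfl, isConical_of_mem_limitCenters hxy.symm ?_ hc⟩
    exact fun a => (h a).imp fun V hV => ⟨hV.1, fun g hg h1 h2 => hV.2 g hg h2 h1⟩

/-- A contracting element has a conical point in the complement of the contracted set. -/
theorem exists_isConical_of_contracting [ContinuousConstSMul G X] (hconv : IsConvergence G X)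
    {g : G} {R A : Set X}
    (hR : IsClosed R) (hA : IsClosed A) (hRA : Disjoint R A) (hnt : (R ∪ A)ᶜ.Nontrivial)
    (hg : ∀ z ∉ R, g • z ∈ A) : ∃ p ∈ R, IsConical G p := by
  have hpow : ∀ (n : ℕ), ∀ z ∉ R, g ^ (n + 1) • z ∈ A := by
    intro n
    induction n with
    | zero => simpa using hg
    | succ n ih =>
      intro z hz
      rw [pow_succ', mul_smul]
      exact hg _ fun h => hRA.le_bot ⟨h, ih z hz⟩
  obtain ⟨z, hz⟩ := hnt.nonempty
  rw [mem_compl_iff, mem_union, not_or] at hz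
  let S : Set G := range fun n : ℕ => g ^ (n + 1)
  have hS : S.Infinite := by
    refine infinite_range_of_injective ?_
    have hinj : Function.Injective fun n : ℕ => g ^ n := by
      refine injective_pow_iff_not_isOfFinOrder.2 fun hfin => ?_
      obtain ⟨n, hn, hgn⟩ := isOfFinOrder_iff_pow_eq_one.1 hfin
      obtain ⟨n, rfl⟩ := Nat.exists_eq_succ_of_ne_zero hn.ne'
      have := hpow n z hz.1
      rw [hgn, one_smul] at this
      exact hz.2 this
    exact fun m n hmn => by simpa using hinj hmn
  have hSR : ∀ h ∈ S, ∀ z ∉ R, h • z ∈ A := by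
    rintro _ ⟨n, rfl⟩
    exact hpow n
  have hrep : repellingSet X S ⊆ R := (repellingSet_subset_closure
    (hnt.mono (compl_subset_compl.2 subset_union_right)) hSR).trans hR.closure_eq.subset
  obtain ⟨⟨r, a⟩, hra⟩ := hconv.limitCenters_nonempty hS
  -- Right multiplication by `g⁻¹` alters the set of positive powers only by the identity, and a
  -- finite set has no limit crosses. So the forward orbit of `r` consists of repellers and stays in
  -- `R`.
  have hinv : ∀ n : ℕ, (g ^ n • r, a) ∈ limitCenters X S := by
    intro n
    induction n with
    | zero => simpa using hra
    | succ n ih =>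
      have h1 := limitCenters_translate g 1 ih
      have h2 : (fun s => 1 * s * g⁻¹) '' S ⊆ {1} ∪ S := by
        rintro _ ⟨_, ⟨n, rfl⟩, rfl⟩
        rcases n with _ | n
        · exact Or.inl (by simp)
        · exact Or.inr ⟨n, by simp [pow_succ]⟩
      have h3 := limitCenters_mono h2 h1
      rw [limitCenters_union] at h3
      rcases h3 with h3 | h3
      · exact (infinite_of_mem_limitCenters h3 (finite_singleton 1)).elim
      · simpa [pow_succ', mul_smul] using h3
  have hrR : ∀ n : ℕ, g ^ n • r ∈ R := fun n => hrep ⟨_, hinv n, rfl⟩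
  have hrz : r ≠ z := by
    rintro rfl
    exact hz.1 (by simpa using hrR 0)
  -- The positive powers keep `r` in `R` and send `z` into `A`; these are disjoint closed sets, so
  -- the two points are never brought together.
  obtain ⟨p, hp, -, hpc⟩ := exists_isConical_of_separated hconv hS hrz (by
    intro b
    by_cases hb : b ∈ R
    · refine ⟨Aᶜ, hA.isOpen_compl.mem_nhds fun h => hRA.le_bot ⟨hb, h⟩, ?_⟩
      exact fun h hh _ h' => h' (hSR h hh z hz.1)
    · refine ⟨Rᶜ, hR.isOpen_compl.mem_nhds hb, ?_⟩
      rintro _ ⟨n, rfl⟩ h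
      exact absurd (hrR (n + 1)) h)
  exact ⟨p, hrep hp, hpc⟩

theorem exists_closed_nhds_disjoint {r a : X} (hra : r ≠ a) :
    ∃ R ∈ 𝓝 r, ∃ A ∈ 𝓝 a, IsClosed R ∧ IsClosed A ∧ Disjoint R A ∧ (R ∪ A)ᶜ.Nontrivial := by
  obtain ⟨U, V, hU, hV, hUV⟩ := t2_separation_nhds hra
  obtain ⟨z, hz⟩ := (Set.toFinite {r, a}).exists_notMem
  obtain ⟨z', hz'⟩ := (Set.toFinite {r, a, z}).exists_notMem
  simp only [mem_insert_iff, mem_singleton_iff, not_or] at hz hz'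
  have hO : IsOpen ({z, z'}ᶜ : Set X) := (Set.toFinite {z, z'}).isClosed.isOpen_compl
  obtain ⟨R, hR, hRc, hRU⟩ := exists_mem_nhds_isClosed_subset (inter_mem hU
    (hO.mem_nhds (by simp [Ne.symm hz.1, Ne.symm hz'.1] : r ∈ _)))
  obtain ⟨A, hA, hAc, hAV⟩ := exists_mem_nhds_isClosed_subset (inter_mem hV
    (hO.mem_nhds (by simp [Ne.symm hz.2, Ne.symm hz'.2.1] : a ∈ _)))
  refine ⟨R, hR, A, hA, hRc, hAc, hUV.mono (hRU.trans inter_subset_left)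
    (hAV.trans inter_subset_left), z, ?_, z', ?_, Ne.symm hz'.2.2⟩
  · exact fun h => h.elim (fun h => (hRU h).2 (by simp)) (fun h => (hAV h).2 (by simp))
  · exact fun h => h.elim (fun h => (hRU h).2 (by simp)) (fun h => (hAV h).2 (by simp))

/-- An off-diagonal limit center gives a contracting element directly. Otherwise there are centers
`(p, p)` and `(q, q)`: contract into a neighborhood of `q`, then into one of `p`, and use the
product. The inverse contracts in the opposite direction, which gives the second point. -/
theorem nontrivial_isConical [ContinuousConstSMul G X] (hconv : IsConvergence G X)
    (hlim : (limitSet G X).Nontrivial) : {p : X | IsConical G p}.Nontrivial := by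
  obtain ⟨g, R, A, hR, hA, hRA, hnt, hg⟩ : ∃ (g : G) (R A : Set X), IsClosed R ∧ IsClosed A ∧
      Disjoint R A ∧ (R ∪ A)ᶜ.Nontrivial ∧ ∀ z ∉ R, g • z ∈ A := by
    by_cases h : ∃ r a : X, (r, a) ∈ limitCenters X (univ : Set G) ∧ r ≠ a
    · obtain ⟨r, a, hc, hra⟩ := h
      obtain ⟨R, hR, A, hA, hRc, hAc, hd, hnt⟩ := exists_closed_nhds_disjoint hra
      obtain ⟨g, -, hg⟩ := mem_limitCenters_iff.1 hc R hR A hA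
      exact ⟨g, R, A, hRc, hAc, hd, hnt, hg⟩
    · push Not at h
      obtain ⟨_, ⟨⟨p, p'⟩, hp, rfl⟩, _, ⟨⟨q, q'⟩, hq, rfl⟩, hpq⟩ := hlim
      obtain rfl := h p p' hp
      obtain rfl := h q q' hq
      obtain ⟨P, hP, Q, hQ, hPc, hQc, hd, hnt⟩ := exists_closed_nhds_disjoint hpq
      obtain ⟨g, -, hg⟩ := mem_limitCenters_iff.1 hp P hP P hP
      obtain ⟨h, -, hh⟩ := mem_limitCenters_iff.1 hq Q hQ Q hQ
      refine ⟨g * h, Q, P, hQc, hPc, hd.symm, by rwa [union_comm], fun z hz => ?_⟩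
      rw [mul_smul]
      exact hg _ fun hn => hd.le_bot ⟨hn, hh z hz⟩
  obtain ⟨p, hp, hpc⟩ := exists_isConical_of_contracting hconv hR hA hRA hnt hg
  obtain ⟨q, hq, hqc⟩ := exists_isConical_of_contracting hconv (g := g⁻¹) hA hR hRA.symm
    (by rwa [union_comm]) fun z hz => by
      by_contra h
      exact hz (by simpa using hg _ h)
  exact ⟨p, hpc, q, hqc, fun e => hRA.le_bot ⟨hp, e ▸ hq⟩⟩

end ConicalPoints

/-! ### Perspective dividers -/

section Dividers

/-- Inverse images under equivariant maps commute with translation. -/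
theorem preimage_smul_prodMap {G X M : Type*} [Group G] [MulAction G X] [MulAction G M] {i : M → X}
    (hi : ∀ (g : G) m, i (g • m) = g • i m) (u : Set (X × X)) (g : G) :
    Prod.map i i ⁻¹' (g • u) = g • (Prod.map i i ⁻¹' u) := by
  ext ⟨x, y⟩
  simp [mem_smul_set_iff_inv_smul_mem, hi]

theorem IsDivider.preimage {G X M : Type*} [Group G] [MulAction G X] [MulAction G M] {i : M → X}
    (hi : ∀ (g : G) m, i (g • m) = g • i m) {u : Set (X × X)} (hu : IsDivider G u) :
    IsDivider G (Prod.map i i ⁻¹' u) := by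
  refine ⟨fun x => hu.refl _, fun x y h => hu.symm _ _ h, ?_⟩
  obtain ⟨F, hF⟩ := hu.divides
  have key : ∀ x y : M, (x, y) ∈ ⋂ f ∈ F, f • (Prod.map i i ⁻¹' u) →
      (i x, i y) ∈ ⋂ f ∈ F, f • u := by
    intro x y h
    refine mem_iInter₂.2 fun f hf => ?_
    have := mem_iInter₂.1 h f hf
    rwa [← preimage_smul_prodMap hi] at this
  exact ⟨F, fun x y z hxy hyz => hF _ _ _ (key _ _ hxy) (key _ _ hyz)⟩

variable {G X : Type*} [Group G] [MulAction G X] [UniformSpace X] [CompactSpace X] [T2Space X]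

theorem isPerspective_preimage [Infinite X] (hconv : IsConvergence G X) {M : Type*} [MulAction G M]
    {i : M → X} (hi : ∀ (g : G) m, i (g • m) = g • i m) (hM : ∀ m, ¬ IsConical G (i m))
    {u : Set (X × X)} (hu : u ∈ 𝓤 X) : IsPerspective G (Prod.map i i ⁻¹' u) := by
  rintro ⟨x, y⟩
  by_contra hinf
  replace hinf : Set.Infinite _ := hinf
  by_cases hxy : i x = i y
  · obtain ⟨g, hg⟩ := hinf.nonempty
    refine hg ?_
    change (i (g • x), i (g • y)) ∈ u
    rw [hi, hi, hxy]
    exact refl_mem_uniformity hu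
  obtain ⟨p, -, hp, hpc⟩ := exists_isConical_of_separated hconv hinf hxy (by
    intro a
    obtain ⟨V, hV, V', hV', hVV⟩ := mem_nhds_prod_iff.1
      (show u ∈ 𝓝 (a, a) from nhds_le_uniformity a hu)
    refine ⟨V ∩ V', inter_mem hV hV', fun g hg h1 h2 => hg ?_⟩
    change (i (g • x), i (g • y)) ∈ u
    rw [hi, hi]
    exact hVV ⟨h1.1, h2.2⟩)
  rcases hp with rfl | rfl
  · exact hM _ hpc
  · exact hM _ hpc

/-- If `g` moves an off-diagonal pair into `K`, the pair lies outside `g⁻¹ • u`. So the closed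
translates of `u` intersect in the diagonal, and finite intersections enter every entourage. Applied
to a `W` with `W ○ W ⊆ u`, this is the divider property. -/
theorem CocompactOnPairs.exists_divider [ContinuousConstSMul G X] (h : CocompactOnPairs G X) :
    ∃ u ∈ 𝓤 X, IsDivider G u ∧ 𝓤 X = ⨅ g : G, 𝓟 (g • u) := by
  obtain ⟨K, hK, hKd, hKG⟩ := h
  have hKu : Kᶜ ∈ 𝓤 X := by
    rw [← nhdsSet_diagonal_eq_uniformity]
    refine hK.isClosed.isOpen_compl.mem_nhdsSet.2 ?_
    rintro ⟨x, y⟩ hxy hxyK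
    exact hKd _ hxyK hxy
  obtain ⟨v, ⟨hv, hvcl⟩, hvK⟩ := uniformity_hasBasis_closed.mem_iff.1 hKu
  let u : Set (X × X) := v ∩ Prod.swap ⁻¹' v
  have hu : u ∈ 𝓤 X := inter_mem hv (symm_le_uniformity hv)
  have hucl : IsClosed u := hvcl.inter (hvcl.preimage continuous_swap)
  have hsmul : ∀ g : G, g • u ∈ 𝓤 X := by
    intro g
    rw [← nhdsSet_diagonal_eq_uniformity, mem_nhdsSet_iff_forall]
    rintro ⟨x, y⟩ (rfl : x = y)
    have h1 : u ∈ 𝓝 (g⁻¹ • (x, x)) := by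
      rw [← nhdsSet_diagonal_eq_uniformity, mem_nhdsSet_iff_forall] at hu
      exact hu _ rfl
    have := (smul_mem_nhds_smul_iff g).2 h1
    rwa [smul_inv_smul] at this
  have hfin : ∀ W ∈ 𝓤 X, ∃ F : Finset G, (⋂ g ∈ F, g • u) ⊆ W := by
    intro W hW
    rw [← nhdsSet_diagonal_eq_uniformity, mem_nhdsSet_iff_exists] at hW
    obtain ⟨O, hO, hdO, hOW⟩ := hW
    obtain ⟨F, hF⟩ := hO.isClosed_compl.isCompact.elim_finite_subfamily_closed
      (fun g : G => g • u) (fun g => hucl.smul g) (by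
        refine eq_empty_of_forall_notMem ?_
        rintro ⟨x, y⟩ ⟨hxyO, hxy⟩
        have hne : x ≠ y := fun e => hxyO (hdO e)
        obtain ⟨g, hg⟩ := hKG x y hne
        have h1 := mem_iInter.1 hxy g⁻¹
        rw [mem_smul_set_iff_inv_smul_mem, inv_inv] at h1
        exact hvK h1.1 hg)
    refine ⟨F, fun p hp => hOW ?_⟩
    by_contra hpO
    exact (hF ▸ ⟨hpO, hp⟩ : p ∈ (∅ : Set (X × X)))
  refine ⟨u, hu, ⟨fun x => refl_mem_uniformity hu, fun x y h => ⟨h.2, h.1⟩, ?_⟩, ?_⟩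
  · obtain ⟨W, hW, hWu⟩ := comp_mem_uniformity_sets hu
    obtain ⟨F, hF⟩ := hfin W hW
    exact ⟨F, fun x y z hxy hyz => hWu ⟨y, hF hxy, hF hyz⟩⟩
  · refine le_antisymm (le_iInf fun g => le_principal_iff.2 (hsmul g)) fun W hW => ?_
    obtain ⟨F, hF⟩ := hfin W hW
    exact mem_of_superset ((biInter_finset_mem F).2 fun g _ =>
      mem_iInf_of_mem g (mem_principal_self _)) hF


end Dividers

/-! ### Completion and closure in a complete space -/

section Completions

open UniformSpace

/-- Neighborhoods of a point of the closure trace a Cauchy filter on `M`; its limit in the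
completion lies over that point. -/
theorem closure_range_subset_range_extension {M X : Type*} [UniformSpace M] [UniformSpace X]
    [CompleteSpace X] [T2Space X] {i : M → X} (hi : IsUniformInducing i) :
    closure (range i) ⊆ range (Completion.extension i) := by
  intro p hp
  have hne : (comap i (𝓝 p)).NeBot := comap_neBot fun t ht => by
    obtain ⟨_, hm, m, rfl⟩ := mem_closure_iff_nhds.1 hp t ht
    exact ⟨m, hm⟩
  have hc : Cauchy (comap i (𝓝 p)) := cauchy_nhds.comap hi.comap_uniformity.le
  obtain ⟨c, hc⟩ := CompleteSpace.complete (hc.map (Completion.uniformContinuous_coe M))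
  refine ⟨c, tendsto_nhds_unique (f := i) (l := comap i (𝓝 p)) ?_ tendsto_comap⟩
  have h1 : Tendsto ((↑) : M → Completion M) (comap i (𝓝 p)) (𝓝 c) := hc
  have := (Completion.continuous_extension (f := i)).continuousAt.tendsto.comp h1
  simpa [Function.comp_def, Completion.extension_coe hi.uniformContinuous] using this

theorem nontrivial_compl_range_coe {M X : Type*} [UniformSpace M] [UniformSpace X]
    [CompleteSpace X] [T2Space X] {i : M → X} (hi : IsUniformInducing i)
    (h : (closure (range i) \ range i).Nontrivial) :
    ((range ((↑) : M → Completion M))ᶜ).Nontrivial := by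
  obtain ⟨p, ⟨hp, hp'⟩, q, ⟨hq, hq'⟩, hpq⟩ := h
  obtain ⟨c, rfl⟩ := closure_range_subset_range_extension hi hp
  obtain ⟨d, rfl⟩ := closure_range_subset_range_extension hi hq
  refine ⟨c, ?_, d, ?_, fun e => hpq (e ▸ rfl)⟩
  · rintro ⟨m, rfl⟩
    exact hp' ⟨m, (Completion.extension_coe hi.uniformContinuous m).symm⟩
  · rintro ⟨m, rfl⟩
    exact hq' ⟨m, (Completion.extension_coe hi.uniformContinuous m).symm⟩

end Completions

/-! ### Cocompactness on pairs of the attractor sum -/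

namespace AttractorSum

variable {G T : Type*} [Group G] [TopologicalSpace T] [MulAction G T]

/-- A group element can be translated to `1`, which is isolated, so its complement is compact. This
handles all pairs not contained in `T`. -/
theorem cocompactOnPairs [CompactSpace T] [T2Space T] [Infinite T] (hconv : IsConvergence G T)
    (h : CocompactOnPairs G T) : CocompactOnPairs G (AttractorSum G T) := by
  have := compactSpace hconv
  have := t2Space hconv
  obtain ⟨K, hK, hKd, hKG⟩ := h
  let e : AttractorSum G T := ofG 1
  have he : IsCompact ({e}ᶜ : Set (AttractorSum G T)) :=
    (isOpen_singleton_ofG 1).isClosed_compl.isCompact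
  refine ⟨Prod.map ofT ofT '' K ∪ ({e} ×ˢ {e}ᶜ ∪ {e}ᶜ ×ˢ {e}), ?_, ?_, ?_⟩
  · exact (hK.image (isClosedEmbedding_ofT.continuous.prodMap
      isClosedEmbedding_ofT.continuous)).union
      ((isCompact_singleton.prod he).union (he.prod isCompact_singleton))
  · rintro _ (⟨q, hq, rfl⟩ | ⟨h1, h2⟩ | ⟨h1, h2⟩) h3
    · exact hKd q hq (ofT_injective h3)
    · exact h2 (h3 ▸ h1)
    · exact h1 (h3 ▸ h2)
  · rintro (x | x) y hxy
    · refine ⟨x⁻¹, Or.inr (Or.inl ⟨?_, fun hy => hxy ?_⟩)⟩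
      · exact congrArg ofG (inv_mul_cancel x)
      · have : x⁻¹ • y = x⁻¹ • (ofG x : AttractorSum G T) :=
          hy.trans (congrArg ofG (inv_mul_cancel x)).symm
        exact (smul_left_cancel _ this).symm
    · rcases y with y | y
      · refine ⟨y⁻¹, Or.inr (Or.inr ⟨?_, congrArg ofG (inv_mul_cancel y)⟩)⟩
        intro hx
        injection hx
      · obtain ⟨g, hg⟩ := hKG x y fun h => hxy (h ▸ rfl)
        exact ⟨g, Or.inl ⟨_, hg, rfl⟩⟩

end AttractorSum

/-! ### Limit points of the attractor sum -/

namespace AttractorSum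

variable {G T : Type*} [Group G] [TopologicalSpace T] [MulAction G T] [CompactSpace T] [T2Space T]
  [Infinite T]

/-- If the isolated point `ofG k` were a repeller, `g` would send all of `T` off a chosen point of
`T`, although `g` permutes `T`. -/
theorem ofG_notMem_limitSet (hconv : IsConvergence G T) (k : G) :
    ofG k ∉ limitSet G (AttractorSum G T) := by
  have := compactSpace hconv
  have := t2Space hconv
  rintro ⟨⟨r, a⟩, hc, h⟩
  simp only at h
  subst h
  obtain ⟨t, ht⟩ : ∃ t : T, a ≠ ofT t := by
    obtain ⟨s, t, hst⟩ := exists_pair_ne T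
    by_cases h : a = ofT s
    · exact ⟨t, fun h' => hst (ofT_injective (h ▸ h'))⟩
    · exact ⟨s, h⟩
  obtain ⟨g, -, hg⟩ := mem_limitCenters_iff.1 hc _ ((isOpen_singleton_ofG k).mem_nhds rfl) _
    (compl_singleton_mem_nhds ht)
  exact hg (g⁻¹ • ofT t) (fun h => by injection h) (by simp)

theorem not_isConical_ofG (hconv : IsConvergence G T) (k : G) :
    ¬ IsConical G (ofG k : AttractorSum G T) :=
  fun h => ofG_notMem_limitSet hconv k h.mem_limitSet

/-- Choose `k` different from the attractor. If `g` maps everything outside `R` off `ofG k`, then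
`g⁻¹ * k` lies in `R`. -/
theorem limitSet_subset_closure_range_ofG (hconv : IsConvergence G T) :
    limitSet G (AttractorSum G T) ⊆ closure (range ofG) := by
  have := compactSpace hconv
  have := t2Space hconv
  rintro _ ⟨⟨r, a⟩, hc, rfl⟩
  have : Infinite G := infinite_univ_iff.1 (infinite_of_mem_limitCenters hc)
  obtain ⟨k, hk⟩ : ∃ k : G, a ≠ ofG k := by
    obtain ⟨s, t, hst⟩ := exists_pair_ne G
    by_cases h : a = ofG s
    · exact ⟨t, fun h' => hst (ofG_injective (h ▸ h'))⟩
    · exact ⟨s, h⟩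
  refine mem_closure_iff_nhds.2 fun R hR => ?_
  obtain ⟨g, -, hg⟩ := mem_limitCenters_iff.1 hc R hR _ (compl_singleton_mem_nhds hk)
  refine ⟨g⁻¹ • ofG k, ?_, g⁻¹ * k, rfl⟩
  by_contra h
  exact hg _ h (by simp)

theorem limitSet_nontrivial [ContinuousConstSMul G T] (hconv : IsConvergence G T)
    (h : (limitSet G T).Nontrivial) : (limitSet G (AttractorSum G T)).Nontrivial := by
  have := compactSpace hconv
  have := t2Space hconv
  refine (h.image ofT_injective).mono ?_
  rintro _ ⟨_, ⟨⟨r, a⟩, hc, rfl⟩, rfl⟩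
  obtain ⟨f, hf, hfra⟩ := mem_limitCenters_iff_ultrafilter.1 hc
  exact ⟨_, (crossLimit_ofT hconv hfra).mem_limitCenters hf, rfl⟩

end AttractorSum

end RelHyp

/-! ### Assembly -/

theorem mainTheorem8 {G T : Type*} [Group G] [TopologicalSpace T] [CompactSpace T] [T2Space T]
    [MulAction G T] [ContinuousConstSMul G T] (hT : RelHyp.IsRelHyp32 G T)
    (hM : RelHyp.IsConnectedGSet G (RelHyp.nonConical G (RelHyp.AttractorSum G T))) :
    ∃ U : UniformSpace (RelHyp.nonConical G (RelHyp.AttractorSum G T)),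
      U.uniformity = Filter.comap (Prod.map Subtype.val Subtype.val)
        (RelHyp.ent (RelHyp.AttractorSum G T)) ∧
      RelHyp.IsRelHypUniformity G U := by
  open RelHyp AttractorSum in
  have : Infinite T := infinite_of_limitSet_nontrivial hT.two_limit_points
  have hconvT : IsConvergence G T := hT.properOnTriples.isConvergence
  have : CompactSpace (AttractorSum G T) := compactSpace hconvT
  have : T2Space (AttractorSum G T) := t2Space hconvT
  have hconv : IsConvergence G (AttractorSum G T) := isConvergence hconvT
  -- The entourages of this structure are by definition the neighborhoods of the diagonal, so the
  -- required formula for the induced uniformity holds by `rfl`.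
  let _ : UniformSpace (AttractorSum G T) := uniformSpaceOfCompactR1
  let i : nonConical G (AttractorSum G T) → AttractorSum G T := Subtype.val
  have hi : ∀ (g : G) m, i (g • m) = g • i m := fun _ _ => rfl
  have hcon : ∀ m, ¬ IsConical G (i m) := fun m => m.2
  let U : UniformSpace (nonConical G (AttractorSum G T)) := UniformSpace.comap i inferInstance
  refine ⟨U, rfl, hM, ?_, ?_⟩
  · obtain ⟨u, hu, hdiv, hgen⟩ := (cocompactOnPairs hconvT hT.cocompactOnPairs).exists_divider
    refine ⟨Prod.map i i ⁻¹' u, hdiv.preimage hi, isPerspective_preimage hconv hi hcon hu, ?_⟩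
    change Filter.comap (Prod.map i i) (𝓤 (AttractorSum G T)) = _
    simp only [hgen, Filter.comap_iInf, Filter.comap_principal, preimage_smul_prodMap hi]
  · have hind : IsUniformInducing i := ⟨rfl⟩
    refine nontrivial_compl_range_coe hind
      ((nontrivial_isConical hconv (limitSet_nontrivial hconvT hT.two_limit_points)).mono ?_)
    -- A conical point is a limit of group elements, which are non-conical and so belong to `M`; the
    -- point itself does not.
    intro p hp
    refine ⟨closure_mono ?_ (limitSet_subset_closure_range_ofG hconvT (IsConical.mem_limitSet hp)),
      ?_⟩
    · rintro _ ⟨g, rfl⟩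
      exact ⟨⟨ofG g, not_isConical_ofG hconvT g⟩, rfl⟩
    · rintro ⟨m, rfl⟩
      exact m.2 hp
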